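/- Let $l,k$ be positive integers with $2l<k$. Write $\Delta(r,\lambda)$ for the sequence $\frac{\lambda}{r},\frac{\lambda+1}{r},\dots,\frac{\lambda+r-1}{r}$, and for $y>0$ let $$m_{l/k,1}(2;y)=(2\pi)^{l-\frac{1+k}{2}}\,\frac{k^{3/2}}{l}\,\frac1y\;G^{k,0}_{2l,k}\!\left(\frac{l^{2l}y^k}{k^k}\,\Big|\,{\Delta(l,1),\Delta(l,1)\atop \Delta(k,1)}\right),$$ where the Meijer $G$-function is $$G^{k,0}_{2l,k}\!\left(z\,\Big|\,{a_1,\dots,a_{2l}\atop b_1,\dots,b_k}\right)=\frac1{2\pi i}\int_{c-i\infty}^{c+i\infty}\frac{\prod_{i=1}^{k}\Gamma(b_i+s)}{\prod_{i=1}^{2l}\Gamma(a_i+s)}\,z^{-s}\,ds,\qquad z>0,$$ along any vertical line $\operatorname{Re}s=c$ that has all poles of the factors $\Gamma(b_i+s)$ to its left (here: $c>-1/k$). Let $$F^{(2)}_{l/k,1}(x)=\sum_{r=0}^\infty\frac{x^r}{\Gamma(1+\frac lk r)^2}$$ be the Mittag-Leffler function of the Le Roy type with parameters $\alpha=l/k$,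 $\beta=1$, $n=2$. Then $m_{l/k,1}(2;y)$ is real and nonnegative for every $y>0$; it is the weight in the absolutely convergent Laplace representation $$F^{(2)}_{l/k,1}(-x)=\int_0^\infty e^{-xy}\,m_{l/k,1}(2;y)\,dy,\qquad x\in\mathbb R;$$ and, consequently, $x\mapsto F^{(2)}_{l/k,1}(-x)$ is completely monotone on $(0,\infty)$: it is of class $C^\infty$ there and $(-1)^j\frac{d^j}{dx^j}F^{(2)}_{l/k,1}(-x)\ge 0$ for all $j\ge0$ and $x>0$. -/

import Mathlib

open Real Set MeasureTheory
open scoped ContDiff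

noncomputable section

/-- The Mittag-Leffler function of the Le Roy type with integer exponent `n`:
`F^{(n)}_{α,β}(x) = ∑_{r ≥ 0} x ^ r / Γ(β + α r) ^ n`. -/
def mittagLefflerLeRoy (n : ℕ) (α β x : ℝ) : ℝ :=
  ∑' r : ℕ, x ^ r / Real.Gamma (β + α * r) ^ n

/-- The sequence `Δ(r, x) = x / r, (x + 1) / r, …, (x + r - 1) / r`. -/
def deltaSeq (r : ℕ) (x : ℂ) : List ℂ :=
  (List.range r).map fun i : ℕ => (x + i) / r

/-- The quotient of Gamma functions in the Mellin-Barnes integral of the Meijer function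
`G^{m,n}_{p,q}` with upper parameters `a` (of length `p`) and lower parameters `b`
(of length `q`). Since `Complex.Gamma` takes the value `0` at its poles, a factor of the
denominator contributes the value `0 = 1 / Γ` there, as it should. -/
def meijerKernel (m n : ℕ) (a b : List ℂ) (s : ℂ) : ℂ :=
  (((b.take m).map fun x => Complex.Gamma (x + s)).prod *
      ((a.take n).map fun x => Complex.Gamma (1 - x - s)).prod) /
    (((a.drop n).map fun x => Complex.Gamma (x + s)).prod *
      ((b.drop m).map fun x => Complex.Gamma (1 - x - s)).prod)

/-- The vertical line `Re s = c` separates the poles of the factors `Γ(b_i + s)`, `i ≤ m`,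
(to its left) from those of the factors `Γ(1 - a_i - s)`, `i ≤ n`, (to its right). -/
def SeparatesPoles (m n : ℕ) (a b : List ℂ) (c : ℝ) : Prop :=
  (∀ x ∈ b.take m, -x.re < c) ∧ ∀ x ∈ a.take n, c < 1 - x.re

/-- The Meijer function `G^{m,n}_{p,q}(z | a ; b)`, `z > 0`, as the Mellin-Barnes integral
`(1 / (2 π i)) ∫ z ^ (-s) * meijerKernel m n a b s ds` along the vertical line `Re s = c`,
where `c` is to satisfy `SeparatesPoles m n a b c`. -/
def meijerG (m n : ℕ) (a b : List ℂ) (c z : ℝ) : ℂ :=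
  mellinInv c (meijerKernel m n a b) z

/-- The upper parameters `Δ(l, β), …, Δ(l, β)` (`n` times) of the weight function. -/
def weightUpper (l n : ℕ) (β : ℝ) : List ℂ :=
  (List.replicate n (deltaSeq l (β : ℂ))).flatten

/-- The weight function `m_{l/k,β}(n; y)`, that is
`(2π)^((1-k)/2 - n(1-l)/2) * k^(3/2) / l^(n(β-1/2)) * y⁻¹ *
  G^{k,0}_{nl,k}(l^(nl) y^k / k^k | Δ(l,β), …, Δ(l,β) ; Δ(k,1))`,
the Meijer function being computed along the line `Re s = c`. -/
def leRoyWeight (l k n : ℕ) (β c y : ℝ) : ℂ :=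
  (((2 * π) ^ ((1 - (k : ℝ)) / 2 - (n : ℝ) * (1 - (l : ℝ)) / 2) *
      ((k : ℝ) ^ (3 / 2 : ℝ) / (l : ℝ) ^ ((n : ℝ) * (β - 1 / 2))) * (1 / y) : ℝ) : ℂ) *
    meijerG k 0 (weightUpper l n β) (deltaSeq k 1) c
      ((l : ℝ) ^ (n * l) * y ^ k / (k : ℝ) ^ k)

/-- `f` is completely monotone on `D`: it is smooth there and
`(-1) ^ n * f^{(n)}(x) ≥ 0` for all `n` and all `x ∈ D`. -/
def CompletelyMonotoneOn (f : ℝ → ℝ) (D : Set ℝ) : Prop :=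
  ContDiffOn ℝ ∞ f D ∧ ∀ n : ℕ, ∀ x ∈ D, 0 ≤ (-1 : ℝ) ^ n * iteratedDerivWithin n f D x

end

/-! The kernel of the weight is ∏_{i<k} Γ((1+i)/k + s) / ∏_{j<l} Γ((1+j)/l + s)². Since 2l < k, the
numerator factors of index 2j and 2j+1 have parameters below (1+j)/l, so each quotient by Γ((1+j)/l
+ s) is the Mellin transform of a Beta density; the unpaired factors come from Gamma densities.
Multiplicative convolution turns the product of these transforms into that of one positive measure μ
(`exists_meijerKernel_weight_eq`). The last factor Γ(1+s) is kept apart: its inverse transform is z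
e^{-z}, and its decay alone justifies Mellin inversion. Hence the Meijer function is ∫ (z/t)
e^{-z/t} dμ(t) ≥ 0 for every admissible contour (`mellinInv_Gamma_mul`).

At the points r/k, Gauss's multiplication formula (`prod_Gamma_add_div`) turns the Mellin transform
into the moments r!/Γ(1+lr/k)² of the weight. Multiplied by (-x)^r/r! and summed, they give the Le
Roy series, which converges for every x by the growth of Γ. So F(-x) is a moment generating function
of a measure on (0,∞), taken at -x, and its derivatives alternate in sign. -/

/-! ### Gauss's multiplication formula -/

theorem prod_sin_pi_mul_div (m : ℕ) :
    ∏ i ∈ Finset.range m, (2 * Real.sin (π * ((i + 1) / (m + 1)))) = m + 1 := by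
  -- For a primitive root ζ of order n = m+1, ∏ (1 - ζ^j) = n over 0 < j < n; the norms are |1 -
  -- e^{iθ}| = 2 sin(θ/2).
  have h := IsPrimitiveRoot.prod_one_sub_pow_eq_order
    (Complex.isPrimitiveRoot_exp (m + 1) (Nat.succ_ne_zero m))
  have h' := congrArg norm h
  rw [norm_prod] at h'
  have hr : ‖(m : ℂ) + 1‖ = (m : ℝ) + 1 := by
    rw [← Nat.cast_add_one, Complex.norm_natCast]; push_cast; ring
  rw [hr] at h'
  refine Eq.trans (Finset.prod_congr rfl fun i hi => ?_) h'
  have hi' : (i : ℝ) + 1 < m + 1 := by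
    have := Finset.mem_range.1 hi
    exact_mod_cast Nat.succ_lt_succ this
  have hm : (0 : ℝ) < m + 1 := by positivity
  have hs : 0 ≤ Real.sin (π * ((i + 1) / (m + 1))) := by
    apply Real.sin_nonneg_of_nonneg_of_le_pi (by positivity)
    have : ((i : ℝ) + 1) / (m + 1) ≤ 1 := (div_le_one hm).2 hi'.le
    nlinarith [Real.pi_pos]
  rw [← Complex.exp_nat_mul, norm_sub_rev]
  have e : ((i + 1 : ℕ) : ℂ) * (2 * π * Complex.I / ((m + 1 : ℕ) : ℂ)) =
      Complex.I * ((2 * (π * ((i + 1) / (m + 1))) : ℝ) : ℂ) := by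
    push_cast; ring
  rw [e, Complex.norm_exp_I_mul_ofReal_sub_one, Real.norm_eq_abs,
    mul_div_cancel_left₀ _ (two_ne_zero), abs_of_nonneg (by positivity)]

/-- The case x = 1 of Gauss's formula. Reversing the order of the factors pairs Γ(u) with Γ(1-u), so
by reflection the square of the product is ∏ π / sin(πu). -/
theorem prod_Gamma_div_succ (m : ℕ) :
    ∏ i ∈ Finset.range (m + 1), Real.Gamma ((1 + i) / (m + 1 : ℕ)) =
      (2 * π) ^ ((m : ℝ) / 2) * ((m + 1 : ℕ) : ℝ) ^ (-(1 / 2) : ℝ) := by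
  have hm : (0 : ℝ) < m + 1 := by positivity
  have hpos : 0 < ∏ i ∈ Finset.range (m + 1), Real.Gamma ((1 + i) / (m + 1 : ℕ)) :=
    Finset.prod_pos fun i _ => Real.Gamma_pos_of_pos (by positivity)
  have hlast : ∏ i ∈ Finset.range (m + 1), Real.Gamma ((1 + i) / (m + 1 : ℕ)) =
      ∏ i ∈ Finset.range m, Real.Gamma ((i + 1) / (m + 1)) := by
    rw [Finset.prod_range_succ]
    have : ((1 : ℝ) + m) / (m + 1 : ℕ) = 1 := by push_cast; field_simp; ring
    rw [this, Real.Gamma_one, mul_one]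
    refine Finset.prod_congr rfl fun i _ => ?_
    push_cast; rw [add_comm (1 : ℝ)]
  have hrefl : ∏ i ∈ Finset.range m, Real.Gamma ((i + 1) / (m + 1)) =
      ∏ i ∈ Finset.range m, Real.Gamma (1 - (i + 1) / (m + 1)) := by
    rw [← Finset.prod_range_reflect]
    refine Finset.prod_congr rfl fun i hi => ?_
    have := Finset.mem_range.1 hi
    congr 1
    rw [Nat.cast_sub (by omega), Nat.cast_sub (by omega)]
    field_simp; push_cast; ring
  have hsq : (∏ i ∈ Finset.range (m + 1), Real.Gamma ((1 + i) / (m + 1 : ℕ))) ^ 2 =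
      (2 * π) ^ m / (m + 1) := by
    rw [sq, hlast]
    nth_rewrite 2 [hrefl]
    rw [← Finset.prod_mul_distrib]
    simp_rw [Real.Gamma_mul_Gamma_one_sub]
    have h2 : (2 * π) ^ m = ∏ _i ∈ Finset.range m, (2 * π) := by simp
    refine Eq.trans ?_ (congrArg ((2 * π) ^ m / ·) (prod_sin_pi_mul_div m))
    simp only [h2]
    rw [← Finset.prod_div_distrib]
    refine Finset.prod_congr rfl fun i _ => ?_
    rw [mul_div_mul_left _ _ two_ne_zero]
  rw [← sq_eq_sq₀ hpos.le (by positivity), hsq, mul_pow ((2 * π) ^ ((m : ℝ) / 2)),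
    ← Real.rpow_mul_natCast (by positivity), ← Real.rpow_mul_natCast (by positivity), ← Real.rpow_natCast]
  push_cast
  rw [div_mul_cancel₀ _ two_ne_zero, show (-(1 / 2) : ℝ) * 2 = -1 by norm_num, Real.rpow_neg_one,
    div_eq_mul_inv]

/-- **Gauss multiplication formula** for the Gamma function on the positive reals. -/
theorem prod_Gamma_add_div (n : ℕ) (hn : 0 < n) {x : ℝ} (hx : 0 < x) :
    ∏ i ∈ Finset.range n, Real.Gamma ((x + i) / n) =
      (2 * π) ^ (((n : ℝ) - 1) / 2) * (n : ℝ) ^ (1 / 2 - x) * Real.Gamma x := by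
  have hn' : (0 : ℝ) < n := by exact_mod_cast hn
  set P : ℝ → ℝ := fun x => ∏ i ∈ Finset.range n, Real.Gamma ((x + i) / n) with hP
  have hPpos : ∀ {x : ℝ}, 0 < x → 0 < P x := fun {x} hx =>
    Finset.prod_pos fun i _ => Real.Gamma_pos_of_pos (by positivity)
  -- Normalised for the Bohr–Mollerup theorem: f(1) = 1, f(y+1) = y f(y) and log f is convex, so f =
  -- Γ.
  set f : ℝ → ℝ := fun x => (n : ℝ) ^ (x - 1) * P x / P 1 with hf
  have hfpos : ∀ {x : ℝ}, 0 < x → 0 < f x := fun {x} hx => by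
    have := hPpos hx
    have := hPpos one_pos
    positivity
  have hlog : ∀ {x : ℝ}, 0 < x → Real.log (f x) = (x - 1) * Real.log n +
      ∑ i ∈ Finset.range n, Real.log (Real.Gamma ((x + i) / n)) - Real.log (P 1) := by
    intro x hx
    have h1 := hPpos hx
    have h2 := hPpos one_pos
    rw [hf]
    simp only
    rw [Real.log_div (by positivity) h2.ne', Real.log_mul (by positivity) h1.ne',
      Real.log_rpow hn', hP, Real.log_prod fun i _ => (Real.Gamma_pos_of_pos (by positivity)).ne']
  have hstep : ∀ {y : ℝ}, 0 < y → f (y + 1) = y * f y := by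
    intro y hy
    -- P(y+1) and P(y) share all factors but one: Γ(y/n) is replaced by Γ(y/n + 1).
    have e : P (y + 1) * Real.Gamma (y / n) = P y * (y / n * Real.Gamma (y / n)) := by
      have h1 := Finset.prod_range_succ (fun i : ℕ => Real.Gamma ((y + i) / n)) n
      rw [Finset.prod_range_succ'] at h1
      have h2 : (y + n) / n = y / n + 1 := by field_simp
      rw [h2, Real.Gamma_add_one (by positivity)] at h1
      simp only [Nat.cast_zero, add_zero] at h1
      rw [← h1, hP]
      congr 1
      refine Finset.prod_congr rfl fun i _ => ?_
      push_cast; ring_nf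
    have hG : Real.Gamma (y / n) ≠ 0 := (Real.Gamma_pos_of_pos (by positivity)).ne'
    have e' : P (y + 1) = P y * (y / n) := by
      apply mul_right_cancel₀ hG; rw [e]; ring
    rw [hf]
    simp only
    rw [e', add_sub_cancel_right, Real.rpow_sub_one hn'.ne']
    field_simp
  have hconv : ConvexOn ℝ (Ioi 0) (Real.log ∘ f) := by
    refine ⟨convex_Ioi 0, fun x hx y hy a b ha hb hab => ?_⟩
    have hxy : 0 < a * x + b * y := (convex_Ioi (0 : ℝ)) hx hy ha hb hab
    simp only [Function.comp, smul_eq_mul]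
    rw [hlog hx, hlog hy, hlog hxy]
    have hs : ∑ i ∈ Finset.range n, Real.log (Real.Gamma ((a * x + b * y + i) / n)) ≤
        a * ∑ i ∈ Finset.range n, Real.log (Real.Gamma ((x + i) / n)) +
        b * ∑ i ∈ Finset.range n, Real.log (Real.Gamma ((y + i) / n)) := by
      rw [Finset.mul_sum, Finset.mul_sum, ← Finset.sum_add_distrib]
      refine Finset.sum_le_sum fun i _ => ?_
      have hx0 : (0 : ℝ) < x := hx
      have hy0 : (0 : ℝ) < y := hy
      have hx' : (x + i) / n ∈ Ioi (0 : ℝ) := by rw [mem_Ioi]; positivity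
      have hy' : (y + i) / n ∈ Ioi (0 : ℝ) := by rw [mem_Ioi]; positivity
      have := Real.convexOn_log_Gamma.2 hx' hy' ha hb hab
      simp only [Function.comp, smul_eq_mul] at this
      refine le_trans (le_of_eq ?_) this
      congr 2
      have : (i : ℝ) = (a + b) * i := by rw [hab, one_mul]
      rw [this]
      field_simp
      linear_combination (-(i : ℝ)) * (a + b) * hab
    have hb' : b = 1 - a := by linarith
    subst hb'
    linarith
  have hf1 : f 1 = 1 := by
    rw [hf]
    simp [(hPpos one_pos).ne']
  have key := Real.eq_Gamma_of_log_convex hconv hstep hfpos hf1 hx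
  have hP1 : P 1 = (2 * π) ^ (((n : ℝ) - 1) / 2) * (n : ℝ) ^ (-(1 / 2) : ℝ) := by
    obtain ⟨m, rfl⟩ : ∃ m, n = m + 1 := ⟨n - 1, by omega⟩
    rw [hP]
    simp only
    rw [prod_Gamma_div_succ]
    push_cast
    rw [add_sub_cancel_right]
  have hpx : P x = (n : ℝ) ^ (1 - x) * P 1 * Real.Gamma x := by
    rw [← key, hf]
    have := (hPpos one_pos).ne'
    simp only
    field_simp
    rw [mul_assoc, ← Real.rpow_add hn']
    norm_num
  change P x = _
  rw [hpx, hP1]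
  have : (1 : ℝ) / 2 - x = (1 - x) + (-(1 / 2)) := by ring
  rw [this, Real.rpow_add hn']
  ring

/-! ### Mellin transforms of positive measures -/

/-- `M s = ∫ t ^ s dμ(t)` for `Re s > d`, where `μ` is carried by the positive half-line. -/
structure HasMellinStieltjes (μ : Measure ℝ) (d : ℝ) (M : ℂ → ℂ) : Prop where
  ae_pos : ∀ᵐ t ∂μ, 0 < t
  integrable : ∀ s : ℂ, d < s.re → Integrable (fun t : ℝ => (t : ℂ) ^ s) μ
  integral_eq : ∀ s : ℂ, d < s.re → ∫ t : ℝ, (t : ℂ) ^ s ∂μ = M s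

/-- On `Re s > d`, the function `M` is the Mellin transform of a positive measure. -/
def MellinPositive (d : ℝ) (M : ℂ → ℂ) : Prop :=
  ∃ μ : Measure ℝ, SFinite μ ∧ HasMellinStieltjes μ d M

theorem MellinPositive.one (d : ℝ) : MellinPositive d fun _ => 1 := by
  refine ⟨Measure.dirac 1, inferInstance, ?_, fun s _ => ?_, fun s _ => ?_⟩
  · rw [ae_dirac_eq]; exact (zero_lt_one : (0 : ℝ) < 1)
  · exact integrable_dirac (by simp)
  · simp

/-- The image of the product measure under (t, u) ↦ tu works, because (tu)^s = t^s u^s for positive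
t and u. -/
theorem MellinPositive.mul {d : ℝ} {M N : ℂ → ℂ} (hM : MellinPositive d M)
    (hN : MellinPositive d N) : MellinPositive d fun s => M s * N s := by
  obtain ⟨μ, _, hμ⟩ := hM
  obtain ⟨ν, _, hν⟩ := hN
  have hpos : ∀ᵐ p ∂μ.prod ν, 0 < p.1 ∧ 0 < p.2 := by
    have h1 : ∀ᵐ p ∂μ.prod ν, 0 < p.1 := Measure.quasiMeasurePreserving_fst.ae hμ.ae_pos
    have h2 : ∀ᵐ p ∂μ.prod ν, 0 < p.2 := Measure.quasiMeasurePreserving_snd.ae hν.ae_pos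
    filter_upwards [h1, h2] with p hp1 hp2 using ⟨hp1, hp2⟩
  have hmeas : Measurable fun p : ℝ × ℝ => p.1 * p.2 := by fun_prop
  have hcongr : ∀ s : ℂ, (fun p : ℝ × ℝ => (p.1 : ℂ) ^ s * (p.2 : ℂ) ^ s) =ᵐ[μ.prod ν]
      fun p : ℝ × ℝ => ((p.1 * p.2 : ℝ) : ℂ) ^ s := fun s => by
    filter_upwards [hpos] with p hp
    rw [Complex.ofReal_mul, Complex.mul_cpow_ofReal_nonneg hp.1.le hp.2.le]
  have hcpow : ∀ s : ℂ, Measurable fun t : ℝ => (t : ℂ) ^ s := fun s =>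
    Complex.measurable_ofReal.pow_const s
  refine ⟨(μ.prod ν).map fun p => p.1 * p.2, inferInstance, ?_, fun s hs => ?_, fun s hs => ?_⟩
  · rw [ae_map_iff hmeas.aemeasurable measurableSet_Ioi]
    filter_upwards [hpos] with p hp using mul_pos hp.1 hp.2
  · rw [integrable_map_measure (hcpow s).aestronglyMeasurable hmeas.aemeasurable]
    exact ((hμ.integrable s hs).mul_prod (hν.integrable s hs)).congr (hcongr s)
  · rw [integral_map hmeas.aemeasurable (hcpow s).aestronglyMeasurable,
      ← integral_congr_ae (hcongr s),
      integral_prod_mul (fun t : ℝ => (t : ℂ) ^ s) (fun t : ℝ => (t : ℂ) ^ s), hμ.integral_eq s hs,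
      hν.integral_eq s hs]

theorem MellinPositive.prod {d : ℝ} {ι : Type*} (I : Finset ι) {M : ι → ℂ → ℂ}
    (h : ∀ i ∈ I, MellinPositive d (M i)) : MellinPositive d fun s => ∏ i ∈ I, M i s := by
  classical
  induction I using Finset.induction_on with
  | empty => simpa using MellinPositive.one d
  | insert i I hi ih =>
    simp_rw [Finset.prod_insert hi]
    exact (h i (Finset.mem_insert_self i I)).mul
      (ih fun j hj => h j (Finset.mem_insert_of_mem hj))

theorem MellinPositive.of_density {d : ℝ} {M : ℂ → ℂ} {w : ℝ → ℝ} (hw : Measurable w)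
    (hw0 : ∀ t, 0 < t → 0 ≤ w t)
    (hi : ∀ s : ℂ, d < s.re → IntegrableOn (fun t : ℝ => (w t : ℂ) * (t : ℂ) ^ s) (Ioi 0))
    (hM : ∀ s : ℂ, d < s.re → ∫ t : ℝ in Ioi 0, (w t : ℂ) * (t : ℂ) ^ s = M s) :
    MellinPositive d M := by
  have hm : Measurable fun t => ENNReal.ofReal (w t) := hw.ennreal_ofReal
  have hfin : ∀ᵐ t ∂volume.restrict (Ioi (0 : ℝ)), ENNReal.ofReal (w t) < ⊤ :=
    Filter.Eventually.of_forall fun t => ENNReal.ofReal_lt_top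
  have hcongr : ∀ s : ℂ, (fun t : ℝ => (w t : ℂ) * (t : ℂ) ^ s) =ᵐ[volume.restrict (Ioi 0)]
      fun t : ℝ => (ENNReal.ofReal (w t)).toReal • (t : ℂ) ^ s := fun s => by
    filter_upwards [ae_restrict_mem measurableSet_Ioi] with t ht
    rw [ENNReal.toReal_ofReal (hw0 t ht), Complex.real_smul]
  refine ⟨(volume.restrict (Ioi 0)).withDensity fun t => ENNReal.ofReal (w t), inferInstance,
    ?_, fun s hs => ?_, fun s hs => ?_⟩
  · exact (withDensity_absolutelyContinuous _ _).ae_le (ae_restrict_mem measurableSet_Ioi)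
  · rw [integrable_withDensity_iff_integrable_smul' hm hfin]
    exact (hi s hs).congr (hcongr s)
  · rw [integral_withDensity_eq_integral_toReal_smul hm hfin, ← integral_congr_ae (hcongr s),
      hM s hs]

/-- Euler's integral, with density e^{-t} t^{b-1}. -/
theorem MellinPositive.Gamma {b d : ℝ} (hbd : -b ≤ d) :
    MellinPositive d fun s => Complex.Gamma (b + s) := by
  have hre : ∀ s : ℂ, d < s.re → 0 < ((b : ℂ) + s).re := fun s hs => by
    simp only [Complex.add_re, Complex.ofReal_re]; linarith
  have hcongr : ∀ s : ℂ, EqOn (fun t : ℝ => (Real.exp (-t) : ℂ) * (t : ℂ) ^ ((b : ℂ) + s - 1))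
      (fun t : ℝ => ((Real.exp (-t) * t ^ (b - 1) : ℝ) : ℂ) * (t : ℂ) ^ s) (Ioi 0) := by
    intro s t ht
    have ht0 : (t : ℂ) ≠ 0 := Complex.ofReal_ne_zero.2 (ne_of_gt ht)
    simp only
    rw [Complex.ofReal_mul, Complex.ofReal_cpow (le_of_lt ht), mul_assoc, ← Complex.cpow_add _ _ ht0]
    push_cast
    ring_nf
  refine MellinPositive.of_density (w := fun t => Real.exp (-t) * t ^ (b - 1)) (by fun_prop)
    (fun t ht => by positivity) (fun s hs => ?_) (fun s hs => ?_)
  · exact (Complex.GammaIntegral_convergent (hre s hs)).congr_fun (hcongr s) measurableSet_Ioi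
  · rw [Complex.Gamma_eq_integral (hre s hs), Complex.GammaIntegral,
      setIntegral_congr_fun measurableSet_Ioi (hcongr s)]

/-- Euler's Beta integral, with density t^{b-1} (1-t)^{a-b-1} / Γ(a-b) on (0,1); b < a gives
convergence at t = 1. -/
theorem MellinPositive.Gamma_div {a b d : ℝ} (hab : b < a) (hbd : -b ≤ d) :
    MellinPositive d fun s => Complex.Gamma (b + s) / Complex.Gamma (a + s) := by
  have hre : ∀ s : ℂ, d < s.re → 0 < ((b : ℂ) + s).re := fun s hs => by
    simp only [Complex.add_re, Complex.ofReal_re]; linarith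
  have hre' : 0 < ((a - b : ℝ) : ℂ).re := by rw [Complex.ofReal_re]; linarith
  have hG : 0 < Real.Gamma (a - b) := Real.Gamma_pos_of_pos (by linarith)
  set w : ℝ → ℝ := (Ioo 0 1).indicator
    fun t => (Real.Gamma (a - b))⁻¹ * (t ^ (b - 1) * (1 - t) ^ (a - b - 1)) with hw
  have hcongr : ∀ s : ℂ, (fun t : ℝ => (w t : ℂ) * (t : ℂ) ^ s) = (Ioo 0 1).indicator
      fun t : ℝ => ((Real.Gamma (a - b))⁻¹ : ℂ) *
        ((t : ℂ) ^ ((b : ℂ) + s - 1) * (1 - (t : ℂ)) ^ (((a - b : ℝ) : ℂ) - 1)) := by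
    intro s
    ext t
    by_cases ht : t ∈ Ioo (0 : ℝ) 1
    · have ht0 : (t : ℂ) ≠ 0 := Complex.ofReal_ne_zero.2 (ne_of_gt ht.1)
      rw [hw, indicator_of_mem ht, indicator_of_mem ht, Complex.ofReal_mul, Complex.ofReal_mul,
        Complex.ofReal_cpow ht.1.le, Complex.ofReal_cpow (by linarith [ht.2]),
        show (b : ℂ) + s - 1 = ((b - 1 : ℝ) : ℂ) + s by push_cast; ring, Complex.cpow_add _ _ ht0]
      push_cast
      ring
    · rw [hw, indicator_of_notMem ht, indicator_of_notMem ht]; simp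
  have hsub : Ioi (0 : ℝ) ∩ Ioo 0 1 = Ioo 0 1 := inter_eq_right.2 fun t ht => ht.1
  refine MellinPositive.of_density (w := w) ?_ ?_ (fun s hs => ?_) (fun s hs => ?_)
  · exact (by fun_prop : Measurable fun t : ℝ =>
      (Real.Gamma (a - b))⁻¹ * (t ^ (b - 1) * (1 - t) ^ (a - b - 1))).indicator measurableSet_Ioo
  · intro t _
    refine indicator_nonneg (fun t ht => ?_) t
    have h0 := ht.1
    have h1 : 0 < 1 - t := by linarith [ht.2]
    positivity
  · have h := Complex.betaIntegral_convergent (hre s hs) hre'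
    rw [intervalIntegrable_iff_integrableOn_Ioo_of_le zero_le_one] at h
    rw [hcongr s]
    refine Integrable.integrableOn ?_
    rw [integrable_indicator_iff measurableSet_Ioo]
    exact h.const_mul _
  · rw [hcongr s, setIntegral_indicator measurableSet_Ioo, hsub, integral_const_mul,
      ← integral_Ioc_eq_integral_Ioo, ← intervalIntegral.integral_of_le zero_le_one]
    have h := Complex.Gamma_mul_Gamma_eq_betaIntegral (hre s hs) hre'
    rw [Complex.betaIntegral, show (b : ℂ) + s + ((a - b : ℝ) : ℂ) = a + s by push_cast; ring,
      Complex.Gamma_ofReal] at h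
    have hGa : Complex.Gamma (a + s) ≠ 0 := by
      apply Complex.Gamma_ne_zero_of_re_pos
      have := hre s hs
      simp only [Complex.add_re, Complex.ofReal_re] at this ⊢
      linarith
    have hG' : (Real.Gamma (a - b) : ℂ) ≠ 0 := Complex.ofReal_ne_zero.2 hG.ne'
    rw [eq_div_iff hGa]
    field_simp
    rw [mul_comm, ← h, mul_comm]

/-! ### Mellin inversion carried by the factor Γ(1+s) -/

/-- Two steps of the functional equation and |Γ(σ+2+iy)| ≤ Γ(σ+2) give a bound of order 1/(σ²+y²),
which suffices here. -/
theorem integrable_Gamma_vertical {σ : ℝ} (hσ : 0 < σ) :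
    Integrable fun y : ℝ => Complex.Gamma (σ + y * Complex.I) := by
  have hne : ∀ (x y : ℝ), 0 < x → (x : ℂ) + y * Complex.I ≠ 0 := fun x y hx h => by
    have := congrArg Complex.re h
    simp at this; linarith
  have hnorm : ∀ x y : ℝ, ‖(x : ℂ) + y * Complex.I‖ ^ 2 = x ^ 2 + y ^ 2 := fun x y => by
    rw [Complex.sq_norm, Complex.normSq_add_mul_I]
  have hbound : ∀ y : ℝ, ‖Complex.Gamma (σ + y * Complex.I)‖ ≤
      Real.Gamma (σ + 2) * (max 1 (σ ^ 2)⁻¹) * (1 + y ^ 2)⁻¹ := by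
    intro y
    have h0 := hne σ y hσ
    have h1 := hne (σ + 1) y (by linarith)
    have e : Complex.Gamma (((σ + 2 : ℝ) : ℂ) + y * Complex.I) =
        (((σ + 1 : ℝ) : ℂ) + y * Complex.I) * ((σ + y * Complex.I) *
          Complex.Gamma (σ + y * Complex.I)) := by
      rw [← Complex.Gamma_add_one _ h0,
        show (σ : ℂ) + y * Complex.I + 1 = ((σ + 1 : ℝ) : ℂ) + y * Complex.I by push_cast; ring,
        ← Complex.Gamma_add_one _ h1]
      push_cast; ring_nf
    have hle : ‖Complex.Gamma (((σ + 2 : ℝ) : ℂ) + y * Complex.I)‖ ≤ Real.Gamma (σ + 2) := by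
      have hre : (((σ + 2 : ℝ) : ℂ) + y * Complex.I).re = σ + 2 := by simp
      have hpos : 0 < (((σ + 2 : ℝ) : ℂ) + y * Complex.I).re := by rw [hre]; linarith
      rw [Complex.Gamma_eq_integral hpos, Complex.GammaIntegral,
        Real.Gamma_eq_integral (by linarith)]
      refine (norm_integral_le_integral_norm _).trans (le_of_eq ?_)
      refine setIntegral_congr_fun measurableSet_Ioi fun t ht => ?_
      rw [norm_mul, Complex.norm_real, Complex.norm_cpow_eq_rpow_re_of_pos ht, Complex.sub_re, hre,
        Real.norm_of_nonneg (Real.exp_pos _).le, Complex.one_re]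
    rw [e, norm_mul, norm_mul] at hle
    have hsq : ‖(σ : ℂ) + y * Complex.I‖ ^ 2 * ‖Complex.Gamma (σ + y * Complex.I)‖ ≤
        Real.Gamma (σ + 2) := by
      refine le_trans ?_ hle
      rw [sq, mul_assoc]
      refine mul_le_mul_of_nonneg_right ?_ (by positivity)
      rw [← sq_le_sq₀ (norm_nonneg _) (norm_nonneg _), hnorm, hnorm]
      nlinarith
    rw [hnorm] at hsq
    have hG : 0 < Real.Gamma (σ + 2) := Real.Gamma_pos_of_pos (by linarith)
    have hσ2 : 0 < σ ^ 2 := by positivity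
    -- The constant max(1, σ⁻²) serves to compare 1 + y² with σ² + y².
    have hA : 1 ≤ max 1 (σ ^ 2)⁻¹ := le_max_left _ _
    have hB : 1 ≤ max 1 (σ ^ 2)⁻¹ * σ ^ 2 := by
      calc (1 : ℝ) = (σ ^ 2)⁻¹ * σ ^ 2 := by field_simp
        _ ≤ _ := mul_le_mul_of_nonneg_right (le_max_right _ _) hσ2.le
    rw [← div_eq_mul_inv, le_div_iff₀ (by positivity)]
    calc ‖Complex.Gamma (σ + y * Complex.I)‖ * (1 + y ^ 2)
        ≤ ‖Complex.Gamma (σ + y * Complex.I)‖ * (max 1 (σ ^ 2)⁻¹ * (σ ^ 2 + y ^ 2)) := by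
          refine mul_le_mul_of_nonneg_left ?_ (norm_nonneg _)
          nlinarith [sq_nonneg y]
      _ = max 1 (σ ^ 2)⁻¹ * ((σ ^ 2 + y ^ 2) * ‖Complex.Gamma (σ + y * Complex.I)‖) := by ring
      _ ≤ max 1 (σ ^ 2)⁻¹ * Real.Gamma (σ + 2) := by gcongr
      _ = _ := mul_comm _ _
  refine Integrable.mono' (integrable_inv_one_add_sq.const_mul _) ?_
    (Filter.Eventually.of_forall hbound)
  refine Continuous.aestronglyMeasurable ?_
  rw [continuous_iff_continuousAt]
  intro y
  refine ContinuousAt.comp (f := fun y : ℝ => (σ : ℂ) + y * Complex.I)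
    (Complex.differentiableAt_Gamma _ fun m h => ?_).continuousAt (by fun_prop)
  have := congrArg Complex.re h
  simp at this
  have hm : (0 : ℝ) ≤ m := Nat.cast_nonneg m
  linarith

theorem hasMellin_mul_exp_neg {s : ℂ} (hs : -1 < s.re) :
    HasMellin (fun t : ℝ => ((t * Real.exp (-t) : ℝ) : ℂ)) s (Complex.Gamma (1 + s)) := by
  have hre : 0 < (1 + s).re := by simp only [Complex.add_re, Complex.one_re]; linarith
  have hcongr : EqOn (fun t : ℝ => (Real.exp (-t) : ℂ) * (t : ℂ) ^ (1 + s - 1))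
      (fun t : ℝ => (t : ℂ) ^ (s - 1) • ((t * Real.exp (-t) : ℝ) : ℂ)) (Ioi 0) := by
    intro t ht
    have ht0 : (t : ℂ) ≠ 0 := Complex.ofReal_ne_zero.2 (ne_of_gt ht)
    simp only
    rw [show 1 + s - 1 = (s - 1) + 1 by ring, Complex.cpow_add _ _ ht0, Complex.cpow_one,
      smul_eq_mul, Complex.ofReal_mul]
    ring
  refine ⟨(Complex.GammaIntegral_convergent hre).congr_fun hcongr measurableSet_Ioi, ?_⟩
  rw [mellin, ← setIntegral_congr_fun measurableSet_Ioi hcongr, Complex.Gamma_eq_integral hre,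
    Complex.GammaIntegral]

theorem mellinInv_Gamma_one_add {c z : ℝ} (hc : -1 < c) (hz : 0 < z) :
    mellinInv c (fun s => Complex.Gamma (1 + s)) z = ((z * Real.exp (-z) : ℝ) : ℂ) := by
  have hre : ∀ y : ℝ, -1 < ((c : ℂ) + y * Complex.I).re := fun y => by simpa using hc
  have hv : Integrable fun y : ℝ => Complex.Gamma (1 + (c + y * Complex.I)) := by
    have := integrable_Gamma_vertical (σ := 1 + c) (by linarith)
    refine this.congr (Filter.Eventually.of_forall fun y => ?_)
    simp only; congr 1; push_cast; ring
  have h := mellinInv_mellin_eq c (fun t : ℝ => ((t * Real.exp (-t) : ℝ) : ℂ)) hz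
    (hasMellin_mul_exp_neg (by simpa using hc)).1
    (hv.congr (Filter.Eventually.of_forall fun y => ((hasMellin_mul_exp_neg (hre y)).2).symm))
    (by fun_prop)
  rw [← h, mellinInv, mellinInv]
  congr 1
  refine integral_congr_ae (Filter.Eventually.of_forall fun y => ?_)
  simp only
  rw [(hasMellin_mul_exp_neg (hre y)).2]

/-- The Mellin convolution of `z * exp (-z)` with the measure `μ`. -/
noncomputable def expConvolution (μ : Measure ℝ) (z : ℝ) : ℝ :=
  ∫ t, z / t * Real.exp (-(z / t)) ∂μ

theorem expConvolution_nonneg {μ : Measure ℝ} (hμ : ∀ᵐ t ∂μ, 0 < t) {z : ℝ} (hz : 0 ≤ z) :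
    0 ≤ expConvolution μ z := by
  refine integral_nonneg_of_ae ?_
  filter_upwards [hμ] with t ht
  simp only [Pi.zero_apply]
  positivity

/-- Fubini: on the line Re s = c the size of t^s does not depend on Im s, so Γ(1+s) alone provides
integrability along the line and M needs no decay. The inner integral is then the inversion formula
for z e^{-z} at z/t. -/
theorem mellinInv_Gamma_mul {μ : Measure ℝ} [SFinite μ] {d c z : ℝ} {M : ℂ → ℂ}
    (hM : HasMellinStieltjes μ d M) (hd : -1 ≤ d) (hc : d < c) (hz : 0 < z) :
    mellinInv c (fun s => Complex.Gamma (1 + s) * M s) z = (expConvolution μ z : ℂ) := by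
  have hv : Integrable fun y : ℝ => Complex.Gamma (1 + (c + y * Complex.I)) := by
    have := integrable_Gamma_vertical (σ := 1 + c) (by linarith)
    refine this.congr (Filter.Eventually.of_forall fun y => ?_)
    simp only; congr 1; push_cast; ring
  have hre : ∀ y : ℝ, ((c : ℂ) + y * Complex.I).re = c := fun y => by simp
  have hz0 : (z : ℂ) ≠ 0 := Complex.ofReal_ne_zero.2 hz.ne'
  set F : ℝ → ℝ → ℂ := fun y t => (z : ℂ) ^ (-((c : ℂ) + y * Complex.I)) *
    Complex.Gamma (1 + (c + y * Complex.I)) * (t : ℂ) ^ ((c : ℂ) + y * Complex.I) with hF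
  have hFi : Integrable (Function.uncurry F) (volume.prod μ) := by
    have hdom : Integrable (fun p : ℝ × ℝ => (((z ^ (-c) : ℝ) : ℂ) *
        Complex.Gamma (1 + (c + p.1 * Complex.I))) * (p.2 : ℂ) ^ (c : ℂ)) (volume.prod μ) :=
      (hv.const_mul _).mul_prod (hM.integrable c (by simpa using hc))
    refine hdom.mono ?_ ?_
    · refine AEStronglyMeasurable.mul (AEStronglyMeasurable.mul ?_ ?_) ?_
      · refine Measurable.aestronglyMeasurable ?_
        exact Measurable.pow measurable_const (by fun_prop)
      · exact hv.aestronglyMeasurable.comp_fst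
      · refine Measurable.aestronglyMeasurable ?_
        exact Measurable.pow (by fun_prop) (by fun_prop)
    · have h2 : ∀ᵐ p ∂(volume : Measure ℝ).prod μ, 0 < p.2 :=
        Measure.quasiMeasurePreserving_snd.ae hM.ae_pos
      filter_upwards [h2] with p hp
      simp only [hF, Function.uncurry, norm_mul]
      rw [Complex.norm_cpow_eq_rpow_re_of_pos hz, Complex.norm_cpow_eq_rpow_re_of_pos hp,
        Complex.norm_cpow_eq_rpow_re_of_pos hp, Complex.neg_re, hre, Complex.ofReal_re,
        Complex.norm_real, Real.norm_of_nonneg (by positivity)]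
  have h1 : mellinInv c (fun s => Complex.Gamma (1 + s) * M s) z =
      (1 / (2 * π)) • ∫ y : ℝ, ∫ t, F y t ∂μ := by
    rw [mellinInv]
    congr 1
    refine integral_congr_ae (Filter.Eventually.of_forall fun y => ?_)
    simp only [hF]
    rw [integral_const_mul, hM.integral_eq _ (by rw [hre]; exact hc), smul_eq_mul, mul_assoc]
  rw [h1, integral_integral_swap hFi, ← integral_smul, expConvolution, ← integral_complex_ofReal]
  refine integral_congr_ae ?_
  filter_upwards [hM.ae_pos] with t ht
  rw [← mellinInv_Gamma_one_add (c := c) (by linarith) (div_pos hz ht), mellinInv]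
  congr 1
  refine integral_congr_ae (Filter.Eventually.of_forall fun y => ?_)
  simp only [hF, smul_eq_mul]
  rw [Complex.ofReal_div, Complex.div_cpow_ofReal_nonneg hz.le ht.le, Complex.cpow_neg (t : ℂ)]
  have : (t : ℂ) ^ ((c : ℂ) + y * Complex.I) ≠ 0 := by
    rw [Ne, Complex.cpow_eq_zero_iff]
    exact fun h => ht.ne' (Complex.ofReal_eq_zero.1 h.1)
  field_simp

theorem measurable_expConvolution (μ : Measure ℝ) [SFinite μ] : Measurable (expConvolution μ) := by
  refine StronglyMeasurable.measurable ?_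
  exact StronglyMeasurable.integral_prod_right
    (f := fun z t : ℝ => z / t * Real.exp (-(z / t)))
    (Measurable.stronglyMeasurable (by fun_prop))

/-- The dilate of z e^{-z} by t has transform t^s Γ(1+s); integrating this over μ gives the result.
-/
theorem hasMellin_expConvolution {μ : Measure ℝ} [SFinite μ] {d : ℝ} {M : ℂ → ℂ}
    (hM : HasMellinStieltjes μ d M) (hd : -1 ≤ d) {s : ℂ} (hs : d < s.re) :
    HasMellin (fun z => (expConvolution μ z : ℂ)) s (Complex.Gamma (1 + s) * M s) := by
  set e : ℝ → ℂ := fun t => ((t * Real.exp (-t) : ℝ) : ℂ) with he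
  have hdil : ∀ {s : ℂ}, d < s.re → ∀ {t : ℝ}, 0 < t → HasMellin (fun z => e (t⁻¹ * z)) s
      ((t : ℂ) ^ s * Complex.Gamma (1 + s)) := by
    intro s hs t ht
    have h := hasMellin_mul_exp_neg (s := s) (by linarith)
    refine ⟨(MellinConvergent.comp_mul_left (inv_pos.2 ht)).2 h.1, ?_⟩
    rw [mellin_comp_mul_left e s (inv_pos.2 ht), h.2, smul_eq_mul, Complex.ofReal_inv,
      Complex.inv_cpow, Complex.cpow_neg, inv_inv]
    rw [Complex.arg_ofReal_of_nonneg ht.le]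
    exact Real.pi_ne_zero.symm
  set F : ℝ → ℝ → ℂ := fun z t => (z : ℂ) ^ (s - 1) • e (t⁻¹ * z) with hF
  have hFm : AEStronglyMeasurable (Function.uncurry F)
      ((volume.restrict (Ioi (0 : ℝ))).prod μ) := by
    refine Measurable.aestronglyMeasurable ?_
    refine Measurable.mul (Measurable.pow (by fun_prop) measurable_const) ?_
    simp only [he]
    fun_prop
  have hsre : d < ((s.re : ℝ) : ℂ).re := hs
  -- The norms of the integrand form the same integrand at the real exponent Re s, so their integral
  -- in z is known and is μ-integrable in t.
  have hnorm : ∀ᵐ t : ℝ ∂μ, ‖(t : ℂ) ^ ((s.re : ℝ) : ℂ) * Complex.Gamma (1 + ((s.re : ℝ) : ℂ))‖ =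
      ∫ z in Ioi (0 : ℝ), ‖F z t‖ := by
    filter_upwards [hM.ae_pos] with t ht
    have h := (hdil hsre ht).2
    rw [← h, mellin]
    have hEq : EqOn (fun z : ℝ => (z : ℂ) ^ (((s.re : ℝ) : ℂ) - 1) • e (t⁻¹ * z))
        (fun z => ((‖F z t‖ : ℝ) : ℂ)) (Ioi 0) := by
      intro z hz
      have hz' : 0 < z := hz
      have hp : 0 ≤ t⁻¹ * z * Real.exp (-(t⁻¹ * z)) := by positivity
      simp only [hF, he, smul_eq_mul, norm_mul]
      rw [Complex.norm_cpow_eq_rpow_re_of_pos hz', Complex.norm_real,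
        Real.norm_of_nonneg hp, Complex.sub_re, Complex.one_re, Complex.ofReal_mul (z ^ _),
        Complex.ofReal_cpow hz'.le]
      push_cast
      ring
    rw [setIntegral_congr_fun measurableSet_Ioi hEq, integral_complex_ofReal, Complex.norm_real,
      Real.norm_of_nonneg (integral_nonneg fun z => norm_nonneg _)]
  have hFi : Integrable (Function.uncurry F) ((volume.restrict (Ioi (0 : ℝ))).prod μ) := by
    rw [integrable_prod_iff' hFm]
    refine ⟨?_, ?_⟩
    · filter_upwards [hM.ae_pos] with t ht using (hdil hs ht).1
    · exact (((hM.integrable _ hsre).mul_const _).norm).congr hnorm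
  have hint : ∀ z : ℝ, ∫ t, F z t ∂μ = (z : ℂ) ^ (s - 1) • (expConvolution μ z : ℂ) := by
    intro z
    simp only [hF, he]
    rw [integral_smul, integral_complex_ofReal, expConvolution]
    simp_rw [inv_mul_eq_div]
  refine ⟨?_, ?_⟩
  · have h := hFi.integral_prod_left
    simp only [Function.uncurry_apply_pair, hint] at h
    exact h
  · rw [mellin]
    simp_rw [← hint]
    rw [integral_integral_swap hFi, ← hM.integral_eq s hs, mul_comm, ← integral_mul_const]
    refine integral_congr_ae ?_
    filter_upwards [hM.ae_pos] with t ht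
    exact (hdil hs ht).2

/-! ### Convergence of the Le Roy series -/

/-- Only the part t > M of Euler's integral is kept, where t^s ≥ M^s. As M is free, Γ beats every
geometric sequence. -/
theorem rpow_mul_exp_neg_le_Gamma {M s : ℝ} (hM : 0 < M) (hs : 0 ≤ s) :
    M ^ s * Real.exp (-M) ≤ Real.Gamma (1 + s) := by
  have hconv : IntegrableOn (fun t : ℝ => Real.exp (-t) * t ^ s) (Ioi 0) := by
    have := Real.GammaIntegral_convergent (s := 1 + s) (by linarith)
    simpa using this
  rw [Real.Gamma_eq_integral (by linarith), ← integral_exp_neg_Ioi, ← integral_const_mul]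
  simp only [add_sub_cancel_left]
  have hsub : Ioi M ⊆ Ioi 0 := Ioi_subset_Ioi hM.le
  calc ∫ t in Ioi M, M ^ s * Real.exp (-t) ≤ ∫ t in Ioi M, Real.exp (-t) * t ^ s := by
        refine setIntegral_mono_on ((integrableOn_exp_neg_Ioi M).const_mul _)
          (hconv.mono_set hsub) measurableSet_Ioi fun t ht => ?_
        rw [mul_comm]
        have : M ≤ t := le_of_lt ht
        gcongr
    _ ≤ ∫ t in Ioi 0, Real.exp (-t) * t ^ s := by
        refine setIntegral_mono_set hconv ?_ hsub.eventuallyLE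
        filter_upwards [ae_restrict_mem measurableSet_Ioi] with t ht
        have : (0 : ℝ) < t := ht
        simp only [Pi.zero_apply]
        positivity

theorem summable_pow_div_Gamma_sq {α : ℝ} (hα : 0 < α) (x : ℝ) :
    Summable fun r : ℕ => x ^ r / Real.Gamma (1 + α * r) ^ 2 := by
  -- Chosen so that M^{2α} = |x| + 1, which leaves a geometric series of ratio |x|/(|x|+1) < 1.
  set M : ℝ := (|x| + 1) ^ (1 / (2 * α)) with hM
  have hx : 0 ≤ |x| := abs_nonneg x
  have hMpos : 0 < M := by positivity
  have hMα : (M ^ α) ^ 2 = |x| + 1 := by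
    rw [hM, ← Real.rpow_mul (by positivity), ← Real.rpow_mul_natCast (by positivity),
      show 1 / (2 * α) * α * ((2 : ℕ) : ℝ) = 1 by push_cast; field_simp, Real.rpow_one]
  have hgeom : Summable fun r : ℕ => Real.exp M ^ 2 * (|x| / (|x| + 1)) ^ r :=
    (summable_geometric_of_lt_one (by positivity)
      ((div_lt_one (by positivity)).2 (by linarith))).mul_left _
  refine hgeom.of_norm_bounded fun r => ?_
  have h := rpow_mul_exp_neg_le_Gamma hMpos (s := α * r) (by positivity)
  rw [norm_div, norm_pow, Real.norm_eq_abs, Real.norm_of_nonneg (sq_nonneg _)]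
  have h2 : (M ^ (α * r) * Real.exp (-M)) ^ 2 = (|x| + 1) ^ r / Real.exp M ^ 2 := by
    rw [mul_pow, Real.rpow_mul_natCast hMpos.le, ← pow_mul, mul_comm r, pow_mul, hMα, Real.exp_neg,
      inv_pow, div_eq_mul_inv]
  calc |x| ^ r / Real.Gamma (1 + α * r) ^ 2
      ≤ |x| ^ r / (M ^ (α * r) * Real.exp (-M)) ^ 2 := by gcongr
    _ = _ := by rw [h2, div_pow]; field_simp

/-! ### From moments to exponential integrals and complete monotonicity -/

theorem integrable_of_hasSum_of_nonneg {Ω : Type*} [MeasurableSpace Ω] {ν : Measure Ω}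
    {F : ℕ → Ω → ℝ} {f : Ω → ℝ} (hF : ∀ r, Integrable (F r) ν) (hF0 : ∀ r, 0 ≤ᵐ[ν] F r)
    (hf : AEStronglyMeasurable f ν) (hsum : ∀ᵐ a ∂ν, HasSum (fun r => F r a) (f a))
    (hint : Summable fun r => ∫ a, F r a ∂ν) : Integrable f ν := by
  refine ⟨hf, ?_⟩
  rw [hasFiniteIntegral_iff_enorm]
  have h0 : ∀ᵐ a ∂ν, ∀ r, 0 ≤ F r a := ae_all_iff.2 hF0
  have h1 : ∫⁻ a, ‖f a‖ₑ ∂ν = ∫⁻ a, ∑' r, ENNReal.ofReal (F r a) ∂ν := by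
    refine lintegral_congr_ae ?_
    filter_upwards [h0, hsum] with a ha hs
    rw [← ENNReal.ofReal_tsum_of_nonneg ha hs.summable, hs.tsum_eq,
      Real.enorm_of_nonneg (hs.nonneg ha)]
  rw [h1, lintegral_tsum fun r => (hF r).aestronglyMeasurable.aemeasurable.ennreal_ofReal]
  simp_rw [← fun r => ofReal_integral_eq_lintegral_ofReal (hF r) (hF0 r)]
  rw [← ENNReal.ofReal_tsum_of_nonneg (fun r => integral_nonneg_of_ae (hF0 r)) hint]
  exact ENNReal.ofReal_lt_top

section Moments

variable {ν : Measure ℝ} {m : ℕ → ℝ}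

theorem integrable_exp_mul_of_moments (hpos : ∀ᵐ y ∂ν, 0 < y)
    (hi : ∀ r : ℕ, Integrable (fun y => y ^ r) ν) (hm : ∀ r : ℕ, ∫ y, y ^ r ∂ν = m r)
    (hs : ∀ x : ℝ, Summable fun r : ℕ => x ^ r * (m r / r.factorial)) (x : ℝ) :
    Integrable (fun y => Real.exp (x * y)) ν := by
  -- With |x| in place of x the exponential series has nonnegative terms, so Tonelli applies; the
  -- result dominates e^{xy}.
  have habs : Integrable (fun y => Real.exp (|x| * y)) ν := by
    refine integrable_of_hasSum_of_nonneg (F := fun r y => |x| ^ r / r.factorial * y ^ r)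
      (fun r => (hi r).const_mul _) (fun r => ?_) (by fun_prop) ?_ ?_
    · filter_upwards [hpos] with y hy
      simp only [Pi.zero_apply]
      positivity
    · refine Filter.Eventually.of_forall fun y => ?_
      have := NormedSpace.expSeries_div_hasSum_exp (|x| * y)
      rw [← Real.exp_eq_exp_ℝ] at this
      refine this.congr_fun fun r => ?_
      rw [mul_pow]; ring
    · refine (hs |x|).congr fun r => ?_
      rw [integral_const_mul, hm]; ring
  refine habs.mono' (by fun_prop) ?_
  filter_upwards [hpos] with y hy
  rw [Real.norm_of_nonneg (Real.exp_pos _).le]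
  gcongr
  exact le_abs_self x

theorem hasSum_integral_exp_mul_of_moments (hpos : ∀ᵐ y ∂ν, 0 < y)
    (hi : ∀ r : ℕ, Integrable (fun y => y ^ r) ν) (hm : ∀ r : ℕ, ∫ y, y ^ r ∂ν = m r)
    (hs : ∀ x : ℝ, Summable fun r : ℕ => x ^ r * (m r / r.factorial)) (x : ℝ) :
    HasSum (fun r : ℕ => x ^ r * (m r / r.factorial)) (∫ y, Real.exp (x * y) ∂ν) := by
  have h := hasSum_integral_of_summable_integral_norm (μ := ν)
    (F := fun (r : ℕ) y => x ^ r / r.factorial * y ^ r) (fun r => (hi r).const_mul _) ?_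
  · have h2 : ∀ y : ℝ, ∑' r : ℕ, x ^ r / r.factorial * y ^ r = Real.exp (x * y) := fun y => by
      rw [Real.exp_eq_exp_ℝ, ← (NormedSpace.expSeries_div_hasSum_exp (x * y)).tsum_eq]
      refine tsum_congr fun r => ?_
      rw [mul_pow]; ring
    simp_rw [h2, integral_const_mul, hm] at h
    refine h.congr_fun fun r => ?_
    ring
  · refine (hs |x|).congr fun r => ?_
    rw [← hm r, ← integral_div, ← integral_const_mul]
    refine integral_congr_ae ?_
    filter_upwards [hpos] with y hy
    rw [norm_mul, norm_div, norm_pow, Real.norm_eq_abs, Real.norm_of_nonneg (pow_nonneg hy.le r),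
      Real.norm_natCast]
    ring

/-- Differentiation under the integral gives ∫ y^n e^{-xy} dν, and the reflection x ↦ -x contributes
the sign (-1)^n. -/
theorem completelyMonotoneOn_mgf_neg (hpos : ∀ᵐ y ∂ν, 0 < y)
    (hexp : ∀ x : ℝ, Integrable (fun y => Real.exp (x * y)) ν) :
    CompletelyMonotoneOn (fun x => ProbabilityTheory.mgf id ν (-x)) (Ioi 0) := by
  have hset : ProbabilityTheory.integrableExpSet id ν = univ := eq_univ_of_forall hexp
  have hmem : ∀ t : ℝ, t ∈ interior (ProbabilityTheory.integrableExpSet id ν) := fun t => by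
    rw [hset, interior_univ]; trivial
  refine ⟨?_, fun n x hx => ?_⟩
  · have h : ContDiff ℝ ∞ (ProbabilityTheory.mgf id ν) := by
      rw [contDiff_iff_contDiffAt]
      exact fun t => (ProbabilityTheory.analyticAt_mgf (hmem t)).contDiffAt
    exact (h.comp contDiff_neg).contDiffOn
  · rw [iteratedDerivWithin_of_isOpen isOpen_Ioi hx, iteratedDeriv_comp_neg,
      ProbabilityTheory.iteratedDeriv_mgf (hmem _), smul_eq_mul, ← mul_assoc, ← mul_pow]
    norm_num
    refine integral_nonneg_of_ae ?_
    filter_upwards [hpos] with y hy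
    simp only [Pi.zero_apply]
    positivity

end Moments

/-! ### The kernel of the weight: positivity and values at r/k -/

theorem prod_map_deltaSeq (r : ℕ) (x : ℂ) (g : ℂ → ℂ) :
    ((deltaSeq r x).map g).prod = ∏ i ∈ Finset.range r, g ((x + i) / r) := by
  rw [deltaSeq, List.map_map]; rfl

theorem meijerKernel_weight (l k : ℕ) (s : ℂ) :
    meijerKernel k 0 (weightUpper l 2 1) (deltaSeq k 1) s =
      (∏ i ∈ Finset.range k, Complex.Gamma ((1 + i) / k + s)) /
        (∏ i ∈ Finset.range l, Complex.Gamma ((1 + i) / l + s)) ^ 2 := by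
  have hlen : (deltaSeq k 1).length = k := by simp [deltaSeq]
  have htake : (deltaSeq k 1).take k = deltaSeq k 1 := List.take_of_length_le hlen.le
  have hdrop : (deltaSeq k 1).drop k = [] := List.drop_of_length_le hlen.le
  have hup : weightUpper l 2 1 = deltaSeq l 1 ++ deltaSeq l 1 := by
    simp [weightUpper, List.replicate]
  rw [meijerKernel, htake, hdrop, hup]
  simp only [List.take_zero, List.drop_zero, List.map_nil, List.prod_nil, mul_one, List.map_append,
    List.prod_append, prod_map_deltaSeq, sq]

theorem prod_range_two_mul {α : Type*} [CommMonoid α] (f : ℕ → α) (l : ℕ) :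
    ∏ i ∈ Finset.range (2 * l), f i = ∏ j ∈ Finset.range l, f (2 * j) * f (2 * j + 1) := by
  induction l with
  | zero => simp
  | succ l ih =>
    rw [Nat.mul_succ, Finset.prod_range_succ, Finset.prod_range_succ, Finset.prod_range_succ, ih,
      mul_assoc]

theorem exists_meijerKernel_weight_eq {l k : ℕ} (hl : 0 < l) (hlk : 2 * l < k) :
    ∃ M : ℂ → ℂ, MellinPositive (-(1 / k)) M ∧ ∀ s,
      meijerKernel k 0 (weightUpper l 2 1) (deltaSeq k 1) s = Complex.Gamma (1 + s) * M s := by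
  obtain ⟨m, rfl⟩ : ∃ m, k = 2 * l + m + 1 := ⟨k - 2 * l - 1, by omega⟩
  set k := 2 * l + m + 1 with hk
  have hl' : (0 : ℝ) < l := by exact_mod_cast hl
  have hk' : (0 : ℝ) < k := by rw [hk]; positivity
  have hlow : ∀ i : ℕ, -(((1 + i) / k : ℝ)) ≤ -(1 / k) := fun i => by
    rw [neg_le_neg_iff]
    gcongr
    linarith [(Nat.cast_nonneg i : (0 : ℝ) ≤ i)]
  -- Here 2l < k enters: (1+i)/k ≤ 2(1+j)/k < (1+j)/l.
  have hlt : ∀ i j : ℕ, i ≤ 2 * j + 1 → ((1 + i) / k : ℝ) < (1 + j) / l := fun i j hij => by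
    rw [div_lt_div_iff₀ hk' hl']
    have h1 : (i : ℝ) ≤ 2 * j + 1 := by exact_mod_cast hij
    have h2 : 2 * (l : ℝ) < k := by exact_mod_cast hlk
    calc (1 + (i : ℝ)) * l ≤ (1 + j) * (2 * l) := by nlinarith
      _ < (1 + j) * k := by gcongr
  set Γk : ℕ → ℂ → ℂ := fun i s => Complex.Gamma (((1 + i) / k : ℝ) + s) with hΓk
  set Γl : ℕ → ℂ → ℂ := fun j s => Complex.Gamma (((1 + j) / l : ℝ) + s) with hΓl
  -- The index 2l+m = k-1 is left out: its parameter is k/k = 1, which is the separate factor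
  -- Γ(1+s).
  refine ⟨fun s => (∏ j ∈ Finset.range l, (Γk (2 * j) s / Γl j s) * (Γk (2 * j + 1) s / Γl j s)) *
    ∏ i ∈ Finset.range m, Γk (2 * l + i) s, ?_, fun s => ?_⟩
  · refine MellinPositive.mul (MellinPositive.prod _ fun j _ => MellinPositive.mul ?_ ?_)
      (MellinPositive.prod _ fun i _ => ?_)
    · exact MellinPositive.Gamma_div (hlt _ _ (by omega)) (hlow _)
    · exact MellinPositive.Gamma_div (hlt _ _ le_rfl) (hlow _)
    · exact MellinPositive.Gamma (hlow _)
  · have hlast : Γk (2 * l + m) s = Complex.Gamma (1 + s) := by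
      have : ((1 + (2 * l + m : ℕ)) / k : ℝ) = 1 := by
        rw [div_eq_one_iff_eq hk'.ne', hk]; push_cast; ring
      simp only [hΓk, this, Complex.ofReal_one]
    have hnum : ∏ i ∈ Finset.range k, Complex.Gamma ((1 + i) / k + s) =
        ∏ i ∈ Finset.range k, Γk i s :=
      Finset.prod_congr rfl fun i _ => by simp only [hΓk]; push_cast; rfl
    have hden : ∏ j ∈ Finset.range l, Complex.Gamma ((1 + j) / l + s) =
        ∏ j ∈ Finset.range l, Γl j s :=
      Finset.prod_congr rfl fun i _ => by simp only [hΓl]; push_cast; rfl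
    rw [meijerKernel_weight, hnum, hden]
    conv_lhs => rw [hk, Finset.prod_range_succ, hlast, Finset.prod_range_add, prod_range_two_mul]
    simp only [div_mul_div_comm, Finset.prod_div_distrib, Finset.prod_mul_distrib]
    ring

theorem prod_Gamma_shift (n : ℕ) (hn : 0 < n) {t : ℝ} (ht : 0 ≤ t) :
    ∏ i ∈ Finset.range n, Complex.Gamma ((1 + i) / n + (t : ℂ)) =
      (((2 * π) ^ (((n : ℝ) - 1) / 2) * (n : ℝ) ^ (-(1 / 2) - n * t) *
        Real.Gamma (1 + n * t) : ℝ) : ℂ) := by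
  have hn' : (n : ℝ) ≠ 0 := by exact_mod_cast hn.ne'
  have h := prod_Gamma_add_div n hn (x := 1 + n * t) (by positivity)
  rw [show (1 : ℝ) / 2 - (1 + n * t) = -(1 / 2) - n * t by ring] at h
  rw [← h, Complex.ofReal_prod]
  refine Finset.prod_congr rfl fun i _ => ?_
  rw [← Complex.Gamma_ofReal]
  congr 1
  have hnC : (n : ℂ) ≠ 0 := by exact_mod_cast hn.ne'
  push_cast
  field_simp
  ring

/-- The numerical factor of `leRoyWeight l k 2 1`. -/
noncomputable def leRoyConst (l k : ℕ) : ℝ :=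
  (2 * π) ^ ((1 - (k : ℝ)) / 2 - ((2 : ℕ) : ℝ) * (1 - (l : ℝ)) / 2) *
    ((k : ℝ) ^ (3 / 2 : ℝ) / (l : ℝ) ^ (((2 : ℕ) : ℝ) * ((1 : ℝ) - 1 / 2)))

/-- The left side is the r-th moment of the weight: k⁻¹ and the power with exponent -r/k come from
the substitution z = l^{2l} y^k / k^k. Gauss's formula turns the numerator into Γ(1+r) and the
denominator into Γ(1+lr/k)², and the prefactor cancels all powers of 2π, k and l. -/
theorem leRoyConst_mul_meijerKernel {l k : ℕ} (hl : 0 < l) (hk : 0 < k) (r : ℕ) :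
    (leRoyConst l k : ℂ) * ((k : ℂ)⁻¹ *
      ((((l : ℝ) ^ (2 * l) / (k : ℝ) ^ k : ℝ) : ℂ) ^ (-((r : ℂ) / k)) *
      meijerKernel k 0 (weightUpper l 2 1) (deltaSeq k 1) ((r : ℂ) / k))) =
      ((r.factorial / Real.Gamma (1 + (l : ℝ) / k * r) ^ 2 : ℝ) : ℂ) := by
  have hl' : (0 : ℝ) < l := by exact_mod_cast hl
  have hk' : (0 : ℝ) < k := by exact_mod_cast hk
  have ht : (0 : ℝ) ≤ r / k := by positivity
  have hrk : (r : ℂ) / k = ((r / k : ℝ) : ℂ) := by push_cast; rfl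
  have hkt : (k : ℝ) * (r / k) = r := by field_simp
  have hlt : (l : ℝ) * (r / k) = l / k * r := by ring
  have hΓ : Real.Gamma (1 + (l : ℝ) / k * r) ≠ 0 := (Real.Gamma_pos_of_pos (by positivity)).ne'
  have hlam : ((l : ℝ) ^ (2 * l) / (k : ℝ) ^ k) ^ (-((r : ℝ) / k)) =
      (l : ℝ) ^ (-(2 * (l / k * r) : ℝ)) * (k : ℝ) ^ (r : ℝ) := by
    rw [Real.div_rpow (by positivity) (by positivity), ← Real.rpow_natCast, ← Real.rpow_natCast (k : ℝ),
      ← Real.rpow_mul hl'.le, ← Real.rpow_mul hk'.le,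
      mul_neg (k : ℝ), hkt, Real.rpow_neg hk'.le, div_inv_eq_mul]
    congr 2
    push_cast; ring
  rw [meijerKernel_weight, hrk, prod_Gamma_shift k hk ht, prod_Gamma_shift l hl ht, hkt, hlt,
    ← Complex.ofReal_neg, ← Complex.ofReal_cpow (by positivity), hlam, add_comm (1 : ℝ) (r : ℝ),
    Real.Gamma_nat_eq_factorial, leRoyConst]
  simp only [← Complex.ofReal_natCast, ← Complex.ofReal_inv, ← Complex.ofReal_pow,
    ← Complex.ofReal_div, ← Complex.ofReal_mul]
  rw [Complex.ofReal_inj, mul_pow, mul_pow, ← Real.rpow_mul_natCast (by positivity),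
    ← Real.rpow_mul_natCast hl'.le]
  have e1 : (2 * π) ^ ((1 - (k : ℝ)) / 2 - ((2 : ℕ) : ℝ) * (1 - (l : ℝ)) / 2) *
      (2 * π) ^ (((k : ℝ) - 1) / 2) = (2 * π) ^ (((l : ℝ) - 1) / 2 * (2 : ℕ)) := by
    rw [← Real.rpow_add (by positivity)]
    congr 1; push_cast; ring
  have e2 : (k : ℝ) ^ (3 / 2 : ℝ) * ((k : ℝ) ^ (r : ℝ) * (k : ℝ) ^ (-(1 / 2) - (r : ℝ))) = k := by
    rw [← Real.rpow_add hk', ← Real.rpow_add hk']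
    ring_nf
    exact Real.rpow_one _
  have e3 : (l : ℝ) ^ (-(2 * (l / k * r) : ℝ)) = (l : ℝ) ^ (((2 : ℕ) : ℝ) * ((1 : ℝ) - 1 / 2)) *
      (l : ℝ) ^ ((-(1 / 2) - (l : ℝ) / k * r) * (2 : ℕ)) := by
    rw [← Real.rpow_add hl']
    congr 1; push_cast; ring
  have hπ : (0 : ℝ) < (2 * π) ^ (((l : ℝ) - 1) / 2 * (2 : ℕ)) := by positivity
  have hL1 : (0 : ℝ) < (l : ℝ) ^ (((2 : ℕ) : ℝ) * ((1 : ℝ) - 1 / 2)) := by positivity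
  have hL2 : (0 : ℝ) < (l : ℝ) ^ ((-(1 / 2) - (l : ℝ) / k * r) * (2 : ℕ)) := by positivity
  rw [e3]
  generalize (l : ℝ) ^ (((2 : ℕ) : ℝ) * ((1 : ℝ) - 1 / 2)) = L1 at *
  generalize (l : ℝ) ^ ((-(1 / 2) - (l : ℝ) / k * r) * (2 : ℕ)) = L2 at *
  generalize (2 * π) ^ (((l : ℝ) - 1) / 2 * (2 : ℕ)) = C at *
  generalize (2 * π) ^ ((1 - (k : ℝ)) / 2 - ((2 : ℕ) : ℝ) * (1 - (l : ℝ)) / 2) = A at *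
  generalize (2 * π) ^ (((k : ℝ) - 1) / 2) = B at *
  generalize (k : ℝ) ^ (3 / 2 : ℝ) = K1 at *
  generalize (k : ℝ) ^ (r : ℝ) = K2 at *
  generalize (k : ℝ) ^ (-(1 / 2) - (r : ℝ)) = K3 at *
  field_simp
  linear_combination (K1 * K2 * K3) * e1 + C * e2

theorem integrable_withDensity_Ioi_iff {W : ℝ → ℝ} (hW : Measurable W)
    (hW0 : ∀ y, 0 < y → 0 ≤ W y) (g : ℝ → ℝ) :
    Integrable g ((volume.restrict (Ioi 0)).withDensity fun y => ENNReal.ofReal (W y)) ↔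
      IntegrableOn (fun y => W y * g y) (Ioi 0) := by
  rw [integrable_withDensity_iff_integrable_smul' hW.ennreal_ofReal
    (Filter.Eventually.of_forall fun y => ENNReal.ofReal_lt_top)]
  refine integrable_congr ?_
  filter_upwards [ae_restrict_mem measurableSet_Ioi] with y hy
  rw [ENNReal.toReal_ofReal (hW0 y hy), smul_eq_mul]

theorem integral_withDensity_Ioi {W : ℝ → ℝ} (hW : Measurable W)
    (hW0 : ∀ y, 0 < y → 0 ≤ W y) (g : ℝ → ℝ) :
    ∫ y, g y ∂((volume.restrict (Ioi 0)).withDensity fun y => ENNReal.ofReal (W y)) =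
      ∫ y in Ioi 0, W y * g y := by
  rw [integral_withDensity_eq_integral_toReal_smul hW.ennreal_ofReal
    (Filter.Eventually.of_forall fun y => ENNReal.ofReal_lt_top)]
  refine setIntegral_congr_fun measurableSet_Ioi fun y hy => ?_
  rw [ENNReal.toReal_ofReal (hW0 y hy), smul_eq_mul]

/-! ### The weight, its moments and its Laplace transform -/

/-- W is built from μ alone, before any contour is chosen, so the weight is the same for all
admissible c. -/
theorem exists_real_leRoyWeight {l k : ℕ} (hl : 0 < l) (hlk : 2 * l < k) :
    ∃ W : ℝ → ℝ, Measurable W ∧ (∀ y, 0 < y → 0 ≤ W y) ∧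
      (∀ c : ℝ, SeparatesPoles k 0 (weightUpper l 2 1) (deltaSeq k 1) c →
        ∀ y : ℝ, 0 < y → leRoyWeight l k 2 1 c y = (W y : ℂ)) ∧
      ∀ r : ℕ, IntegrableOn (fun y => W y * y ^ r) (Ioi 0) ∧
        ∫ y in Ioi 0, W y * y ^ r = r.factorial / Real.Gamma (1 + (l : ℝ) / k * r) ^ 2 := by
  obtain ⟨M, ⟨μ, _, hμ⟩, hM⟩ := exists_meijerKernel_weight_eq hl hlk
  have hk : 0 < k := by omega
  have hl' : (0 : ℝ) < l := by exact_mod_cast hl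
  have hk' : (0 : ℝ) < k := by exact_mod_cast hk
  have hd : (-1 : ℝ) ≤ -(1 / k) := by
    rw [neg_le_neg_iff, div_le_one hk']
    exact_mod_cast hk
  set ρ : ℝ := (l : ℝ) ^ (2 * l) / (k : ℝ) ^ k with hρ
  have hρ0 : 0 < ρ := by positivity
  have hC : 0 ≤ leRoyConst l k := by rw [leRoyConst]; positivity
  set W : ℝ → ℝ := fun y => leRoyConst l k * (1 / y) * expConvolution μ (ρ * y ^ k) with hW
  have hmell : ∀ r : ℕ, HasMellin (fun y : ℝ => (expConvolution μ (ρ * y ^ k) : ℂ)) r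
      ((k : ℂ)⁻¹ * ((ρ : ℂ) ^ (-((r : ℂ) / k)) *
        meijerKernel k 0 (weightUpper l 2 1) (deltaSeq k 1) ((r : ℂ) / k))) := by
    intro r
    have hs : -(1 / k) < ((r : ℂ) / k).re := by
      rw [show (r : ℂ) / k = ((r / k : ℝ) : ℂ) by push_cast; rfl, Complex.ofReal_re]
      have : (0 : ℝ) ≤ r / k := by positivity
      have : (0 : ℝ) < 1 / k := by positivity
      linarith
    have h := hasMellin_expConvolution hμ hd hs
    set f : ℝ → ℂ := fun u => (expConvolution μ (ρ * u) : ℂ) with hf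
    have hf' : (fun y : ℝ => (expConvolution μ (ρ * y ^ k) : ℂ)) = fun y => f (y ^ (k : ℝ)) := by
      ext y; simp only [hf, Real.rpow_natCast]
    rw [hf']
    refine ⟨?_, ?_⟩
    · rw [MellinConvergent.comp_rpow hk'.ne', Complex.ofReal_natCast]
      exact (MellinConvergent.comp_mul_left hρ0).2 h.1
    · rw [mellin_comp_rpow, Complex.ofReal_natCast, hf,
        mellin_comp_mul_left (fun u => (expConvolution μ u : ℂ)) _ hρ0, h.2, ← hM, abs_of_pos hk',
        Complex.real_smul, smul_eq_mul, Complex.ofReal_inv, Complex.ofReal_natCast]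
  -- The factor 1/y of the weight makes the r-th moment a Mellin transform at exactly s = r.
  have hmom : ∀ r : ℕ, EqOn (fun y : ℝ => ((W y * y ^ r : ℝ) : ℂ))
      (fun y : ℝ => (leRoyConst l k : ℂ) *
        ((y : ℂ) ^ ((r : ℂ) - 1) • (expConvolution μ (ρ * y ^ k) : ℂ))) (Ioi 0) := by
    intro r y hy
    have hy0 : (y : ℂ) ≠ 0 := Complex.ofReal_ne_zero.2 (ne_of_gt hy)
    simp only [hW]
    rw [Complex.cpow_sub _ _ hy0, Complex.cpow_one, Complex.cpow_natCast, smul_eq_mul]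
    push_cast
    ring
  refine ⟨W, ?_, fun y hy => ?_, fun c hc y hy => ?_, fun r => ⟨?_, ?_⟩⟩
  · have := measurable_expConvolution μ
    fun_prop
  · have := expConvolution_nonneg hμ.ae_pos (z := ρ * y ^ k) (by positivity)
    simp only [hW]
    positivity
  · have hc' : -(1 / k) < c := by
      -- The smallest lower parameter, 1/k, gives the rightmost pole -1/k.
      have h := hc.1 (((1 : ℂ) + (0 : ℕ)) / k) (by
        rw [List.take_of_length_le (by simp [deltaSeq]), deltaSeq]
        exact List.mem_map.2 ⟨0, List.mem_range.2 hk, rfl⟩)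
      rw [show ((1 : ℂ) + (0 : ℕ)) / k = ((1 / k : ℝ) : ℂ) by push_cast; simp,
        Complex.ofReal_re] at h
      exact h
    have hz : 0 < ρ * y ^ k := by positivity
    have hG := mellinInv_Gamma_mul hμ hd hc' hz
    rw [leRoyWeight, meijerG, funext hM,
      mul_div_right_comm ((l : ℝ) ^ (2 * l)), ← hρ, hG, ← Complex.ofReal_mul]
    rfl
  · have h : IntegrableOn (fun y => ((W y * y ^ r : ℝ) : ℂ)) (Ioi 0) :=
      IntegrableOn.congr_fun ((hmell r).1.const_mul _) (hmom r).symm measurableSet_Ioi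
    exact h.re
  · rw [← Complex.ofReal_inj, ← integral_complex_ofReal,
      setIntegral_congr_fun measurableSet_Ioi (hmom r), integral_const_mul]
    have h := (hmell r).2
    rw [mellin] at h
    rw [h]
    exact leRoyConst_mul_meijerKernel hl hk r

theorem mainTheorem3 (l k : ℕ) (hl : 0 < l) (hlk : 2 * l < k) :
    (∀ c : ℝ, SeparatesPoles k 0 (weightUpper l 2 1) (deltaSeq k 1) c →
      (∀ y : ℝ, 0 < y →
        (leRoyWeight l k 2 1 c y).im = 0 ∧ 0 ≤ (leRoyWeight l k 2 1 c y).re) ∧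
      (∀ x : ℝ,
        IntegrableOn (fun y : ℝ => (Real.exp (-(x * y)) : ℂ) * leRoyWeight l k 2 1 c y)
          (Set.Ioi 0) ∧
        (mittagLefflerLeRoy 2 ((l : ℝ) / k) 1 (-x) : ℂ) =
          ∫ y in Set.Ioi (0 : ℝ), (Real.exp (-(x * y)) : ℂ) * leRoyWeight l k 2 1 c y)) ∧
    CompletelyMonotoneOn (fun x : ℝ => mittagLefflerLeRoy 2 ((l : ℝ) / k) 1 (-x))
      (Set.Ioi 0) := by
  obtain ⟨W, hWm, hW0, hWeq, hWmom⟩ := exists_real_leRoyWeight hl hlk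
  set α : ℝ := (l : ℝ) / k with hα
  have hα0 : 0 < α := by
    have hl' : (0 : ℝ) < l := by exact_mod_cast hl
    have hk' : (0 : ℝ) < k := by exact_mod_cast (by omega : 0 < k)
    positivity
  set ν := (volume.restrict (Ioi 0)).withDensity fun y => ENNReal.ofReal (W y) with hν
  have hpos : ∀ᵐ y ∂ν, 0 < y :=
    (withDensity_absolutelyContinuous _ _).ae_le (ae_restrict_mem measurableSet_Ioi)
  have hi : ∀ r : ℕ, Integrable (fun y => y ^ r) ν := fun r =>
    (integrable_withDensity_Ioi_iff hWm hW0 _).2 (hWmom r).1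
  have hm : ∀ r : ℕ, ∫ y, y ^ r ∂ν = r.factorial / Real.Gamma (1 + α * r) ^ 2 := fun r => by
    rw [hν, integral_withDensity_Ioi hWm hW0, (hWmom r).2]
  -- The r! of the moment cancels the one in the exponential series.
  have hterm : ∀ (x : ℝ) (r : ℕ), x ^ r / Real.Gamma (1 + α * r) ^ 2 =
      x ^ r * (r.factorial / Real.Gamma (1 + α * r) ^ 2 / r.factorial) := fun x r => by
    have : (r.factorial : ℝ) ≠ 0 := by positivity
    field_simp
  have hs : ∀ x : ℝ, Summable fun r : ℕ =>
      x ^ r * (r.factorial / Real.Gamma (1 + α * r) ^ 2 / r.factorial) := fun x =>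
    (summable_pow_div_Gamma_sq hα0 x).congr (hterm x)
  have hexp := integrable_exp_mul_of_moments hpos hi hm hs
  have hF : ∀ x : ℝ, mittagLefflerLeRoy 2 α 1 x = ∫ y, Real.exp (x * y) ∂ν := fun x => by
    rw [← (hasSum_integral_exp_mul_of_moments hpos hi hm hs x).tsum_eq, mittagLefflerLeRoy]
    exact tsum_congr (hterm x)
  refine ⟨fun c hc => ⟨fun y hy => ?_, fun x => ?_⟩, ?_⟩
  · rw [hWeq c hc y hy]
    exact ⟨Complex.ofReal_im _, by rw [Complex.ofReal_re]; exact hW0 y hy⟩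
  · have hcongr : EqOn (fun y : ℝ => ((W y * Real.exp (-x * y) : ℝ) : ℂ))
        (fun y : ℝ => (Real.exp (-(x * y)) : ℂ) * leRoyWeight l k 2 1 c y) (Ioi 0) := by
      intro y hy
      simp only
      rw [hWeq c hc y hy, Complex.ofReal_mul, mul_comm, neg_mul]
    refine ⟨?_, ?_⟩
    · exact IntegrableOn.congr_fun
        ((integrable_withDensity_Ioi_iff hWm hW0 _).1 (hexp (-x))).ofReal hcongr measurableSet_Ioi
    · rw [← setIntegral_congr_fun measurableSet_Ioi hcongr, integral_complex_ofReal, hF,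
        hν, integral_withDensity_Ioi hWm hW0]
  -- By definition ∫ e^{-xy} dν is the moment generating function of the identity at -x.
  · simp_rw [hF]
    exact completelyMonotoneOn_mgf_neg hpos hexp
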